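/- Let $d_x,d_u\ge 1$ be integers, let $R_x\in\mathbb{R}^{d_x\times d_x}$ be a symmetric matrix with $R_x\succeq I$, and let $R_u=I\in\mathbb{R}^{d_u\times d_u}$. A system is a pair $(A,B)$ with $A\in\mathbb{R}^{d_x\times d_x}$ and $B\in\mathbb{R}^{d_x\times d_u}$. It is stabilizable if there is $K\in\mathbb{R}^{d_u\times d_x}$ such that the spectral radius of $A+BK$ is less than $1$. For a stabilizable system, $P_\infty(A,B)$ denotes the unique positive semidefinite solution $P$ of the discrete algebraic Riccati equation $$P=A^\top PA-A^\top PB\,(R_u+B^\top PB)^{-1}B^\top PA+R_x .$$ Let $\|\cdot\|$ be the spectral (Euclidean operator) norm, put $C_{\mathrm{safe}}(A,B)=54\,\|P_\infty(A,B)\|^5$, and $$\mathcal{B}_{\mathrm{op}}(\epsilon;A_0,B_0)=\{(A,B):\max\{\|A-A_0\|,\|B-B_0\|\}\le\epsilon\}.$$ **Theorem.** Let $(A_0,B_0)$ be stabilizable, and let $(\widehat A,\widehat B)$ and $(A_\star,B_\star)$ be any two systems in $\mathcal{B}_{\mathrm{op}}\bigl(\tfrac{1}{3C_{\mathrm{safe}}(A_0,B_0)};A_0,B_0\bigr)$.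 Then $(\widehat A,\widehat B)$ and $(A_\star,B_\star)$ are stabilizable (so that, as for $(A_0,B_0)$, their Riccati equations have unique positive semidefinite solutions), $$\max\{\|A_\star-\widehat A\|,\|\widehat B-B_\star\|\}\le\frac{1}{C_{\mathrm{safe}}(A_\star,B_\star)},\qquad\text{and}\qquad \|P_\infty(A_\star,B_\star)\|\le 1.0835\,\|P_\infty(A_0,B_0)\|.$$ -/

import Mathlib

open scoped Matrix

-- All matrix norms below are the spectral norm, i.e. the operator norm for Euclidean norms.
open scoped Matrix.Norms.L2Operator

namespace LQR

variable {n m : ℕ}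

/-- A real square matrix is stable if its spectral radius, the largest modulus of a complex
eigenvalue, is smaller than one. -/
def IsStable (M : Matrix (Fin n) (Fin n) ℝ) : Prop :=
  spectralRadius ℂ (M.map (algebraMap ℝ ℂ)) < 1

/-- `(A, B)` is stabilizable if some linear state feedback `K` makes `A + B K` stable. -/
def IsStabilizable (A : Matrix (Fin n) (Fin n) ℝ) (B : Matrix (Fin n) (Fin m) ℝ) : Prop :=
  ∃ K : Matrix (Fin m) (Fin n) ℝ, IsStable (A + B * K)

/-- `P` is a positive semidefinite solution of the discrete algebraic Riccati equation of the
system `(A, B)` with state cost `Rx` and input cost `Ru`. -/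
def IsDARESolution (Rx : Matrix (Fin n) (Fin n) ℝ) (Ru : Matrix (Fin m) (Fin m) ℝ)
    (A : Matrix (Fin n) (Fin n) ℝ) (B : Matrix (Fin n) (Fin m) ℝ)
    (P : Matrix (Fin n) (Fin n) ℝ) : Prop :=
  P.PosSemidef ∧ P = Aᵀ * P * A - Aᵀ * P * B * (Ru + Bᵀ * P * B)⁻¹ * Bᵀ * P * A + Rx

open Classical in
/-- The positive semidefinite solution of the discrete algebraic Riccati equation. It exists and
is unique when `(A, B)` is stabilizable and `Rx`, `Ru` are positive definite; the value `0` is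
used only when there is no such solution. -/
noncomputable def PInfty (Rx : Matrix (Fin n) (Fin n) ℝ) (Ru : Matrix (Fin m) (Fin m) ℝ)
    (A : Matrix (Fin n) (Fin n) ℝ) (B : Matrix (Fin n) (Fin m) ℝ) :
    Matrix (Fin n) (Fin n) ℝ :=
  if h : ∃ P, IsDARESolution Rx Ru A B P then h.choose else 0

/-- The constant `54 ‖P_∞(A, B)‖ ^ 5`. -/
noncomputable def CSafe (Rx : Matrix (Fin n) (Fin n) ℝ) (Ru : Matrix (Fin m) (Fin m) ℝ)
    (A : Matrix (Fin n) (Fin n) ℝ) (B : Matrix (Fin n) (Fin m) ℝ) : ℝ :=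
  54 * ‖PInfty Rx Ru A B‖ ^ 5

/-- The systems `(A, B)` with `‖A - A₀‖ ≤ ε` and `‖B - B₀‖ ≤ ε`. -/
def opBall (ε : ℝ) (A₀ : Matrix (Fin n) (Fin n) ℝ) (B₀ : Matrix (Fin n) (Fin m) ℝ) :
    Set (Matrix (Fin n) (Fin n) ℝ × Matrix (Fin n) (Fin m) ℝ) :=
  {S | max ‖S.1 - A₀‖ ‖S.2 - B₀‖ ≤ ε}

end LQR

/-!
For a fixed feedback `K`, completing the square shows that the Riccati operator is the minimum over
`K` of the monotone maps `P ↦ (A + B K)ᴴ P (A + B K) + Kᴴ Ru K + Rx`. It is therefore monotone too,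
and below any `X ≥ 0` that such a map decreases, iterating it from `0` converges to a Riccati
solution `P ≤ X`. The Riccati equation is then a strict Lyapunov inequality for the closed loop of
`P`, so the closed loop is stable; comparing two solutions along stable closed loops gives
uniqueness.

Let `P₀` be the solution for `(A₀, B₀)`, and perturb both matrices by at most `ε`, keeping the
optimal feedback of `P₀`. Young's inequality in the Loewner order,
`(L + D)ᴴ P (L + D) ≤ (1 + ε) Lᴴ P L + (1 + ε⁻¹) Dᴴ P D`, shows that the scaled matrix
`(1 - ε ‖P₀‖ (3 + 2 ε))⁻¹ P₀` is decreased by the perturbed map, which gives stabilizability and the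
bound on `‖P‖` at once. As `‖P₀‖ ≥ 1`, the radius `ε = 1 / (162 ‖P₀‖ ^ 5)` makes the factor less
than `1.0835`, and `1.0835 ^ 5 ≤ 3 / 2` turns this into the bound on the distance.
-/

open scoped MatrixOrder ComplexOrder
open Matrix Filter Topology Set

namespace LQR

section Loewner

variable {𝕜 n m : Type*} [RCLike 𝕜]

lemma posDef_of_one_le [DecidableEq n] {M : Matrix n n 𝕜} (hM : 1 ≤ M) : M.PosDef := by
  simpa using PosDef.one.add_posSemidef (sub_nonneg.2 hM).posSemidef

section

variable [Fintype n] [Finite m]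

lemma conjTranspose_mul_mul_nonneg {P : Matrix n n 𝕜} (hP : 0 ≤ P) (L : Matrix n m 𝕜) :
    0 ≤ Lᴴ * P * L :=
  (hP.posSemidef.conjTranspose_mul_mul_same L).nonneg

lemma posDef_add_conjTranspose_mul_mul {Q : Matrix m m 𝕜} {P : Matrix n n 𝕜} (hQ : Q.PosDef)
    (hP : 0 ≤ P) (L : Matrix n m 𝕜) : (Q + Lᴴ * P * L).PosDef :=
  hQ.add_posSemidef (conjTranspose_mul_mul_nonneg hP L).posSemidef

lemma conjTranspose_mul_mul_mono {P Q : Matrix n n 𝕜} (h : P ≤ Q) (L : Matrix n m 𝕜) :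
    Lᴴ * P * L ≤ Lᴴ * Q * L := by
  rw [← sub_nonneg, ← Matrix.sub_mul, ← Matrix.mul_sub]
  exact conjTranspose_mul_mul_nonneg (sub_nonneg.2 h) L

lemma conjTranspose_mul_self_nonneg (L : Matrix n m 𝕜) : 0 ≤ Lᴴ * L :=
  (posSemidef_conjTranspose_mul_self L).nonneg

lemma conjTranspose_add_mul_mul_add_le {P : Matrix n n 𝕜} (hP : 0 ≤ P) (L D : Matrix n m 𝕜)
    {t : ℝ} (ht : 0 < t) :
    (L + D)ᴴ * P * (L + D) ≤ (1 + t) • (Lᴴ * P * L) + (1 + t⁻¹) • (Dᴴ * P * D) := by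
  cases nonempty_fintype m
  have hsq : (1 + t) • (Lᴴ * P * L) + (1 + t⁻¹) • (Dᴴ * P * D) - (L + D)ᴴ * P * (L + D)
      = t⁻¹ • ((t • L - D)ᴴ * P * (t • L - D)) := by
    simp only [conjTranspose_add, conjTranspose_sub, conjTranspose_smul, star_trivial,
      Matrix.add_mul, Matrix.mul_add, Matrix.sub_mul, Matrix.mul_sub, Matrix.smul_mul,
      Matrix.mul_smul]
    match_scalars <;> field_simp <;> ring
  rw [← sub_nonneg, hsq]
  exact smul_nonneg (inv_nonneg.2 ht.le) (conjTranspose_mul_mul_nonneg hP _)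

end

instance instOrderClosedTopology [Finite n] : OrderClosedTopology (Matrix n n 𝕜) := by
  cases nonempty_fintype n
  have hclosed : IsClosed {P : Matrix n n 𝕜 | 0 ≤ P} := by
    simp only [nonneg_iff_posSemidef, posSemidef_iff_dotProduct_mulVec, Set.ofPred_and,
      Set.ofPred_forall]
    refine (isClosed_eq continuous_id.matrix_conjTranspose continuous_id).inter
      (isClosed_iInter fun x ↦ ?_)
    exact isClosed_le continuous_const
      (continuous_const.dotProduct (continuous_id.matrix_mulVec continuous_const))
  exact ⟨isClosed_le_of_isClosed_nonneg hclosed⟩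

variable [Fintype n] [DecidableEq n]

-- Mathlib has this structure over `𝕜` only; the real functional calculus needs it over `ℝ`.
noncomputable instance instNormedAlgebraReal : NormedAlgebra ℝ (Matrix n n 𝕜) where
  norm_smul_le r P := by rw [← algebraMap_smul 𝕜 r P, norm_smul, norm_algebraMap']

lemma le_norm_smul_one {P : Matrix n n 𝕜} (hP : P.IsHermitian) : P ≤ ‖P‖ • 1 := by
  rw [← Algebra.algebraMap_eq_smul_one]
  exact le_algebraMap_of_spectrum_le (ha := hP) fun x hx ↦ (Real.le_norm_self x).trans
    (IsometricContinuousFunctionalCalculus.norm_spectrum_le P hx hP)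

lemma norm_le_of_le_smul_one {P : Matrix n n 𝕜} {c : ℝ} (hc : 0 ≤ c) (hP : 0 ≤ P)
    (h : P ≤ c • 1) : ‖P‖ ≤ c := by
  have hPsa : IsSelfAdjoint P := hP.posSemidef.isHermitian
  rw [← Algebra.algebraMap_eq_smul_one, le_algebraMap_iff_spectrum_le hPsa] at h
  rw [← cfc_id ℝ P hPsa]
  refine norm_cfc_le hc fun x hx ↦ ?_
  rw [id, Real.norm_of_nonneg (spectrum_nonneg_of_nonneg hP hx)]
  exact h x hx

lemma norm_mono {P Q : Matrix n n 𝕜} (hP : 0 ≤ P) (h : P ≤ Q) : ‖P‖ ≤ ‖Q‖ :=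
  norm_le_of_le_smul_one (norm_nonneg Q) hP
    (h.trans (le_norm_smul_one (hP.trans h).posSemidef.isHermitian))

lemma conjTranspose_mul_self_le_norm_sq_smul_one [Fintype m] (M : Matrix m n 𝕜) :
    Mᴴ * M ≤ ‖M‖ ^ 2 • 1 := by
  rw [sq, ← l2_opNorm_conjTranspose_mul_self]
  exact le_norm_smul_one (isHermitian_conjTranspose_mul_self M)

end Loewner

lemma isCompact_Icc_zero {𝕜 n : Type*} [RCLike 𝕜] [Finite n] (X : Matrix n n 𝕜) :
    IsCompact (Icc 0 X) := by
  cases nonempty_fintype n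
  classical
  have := FiniteDimensional.proper 𝕜 (Matrix n n 𝕜)
  exact Metric.isCompact_of_isClosed_isBounded isClosed_Icc
    (isBounded_iff_forall_norm_le.2 ⟨‖X‖, fun P hP ↦ norm_mono hP.1 hP.2⟩)

section FixedPoint

variable {α : Type*} [PartialOrder α] [TopologicalSpace α] [OrderClosedTopology α]

lemma exists_tendsto_of_monotone_of_isCompact {s : Set α} (hs : IsCompact s) {u : ℕ → α}
    (hu : Monotone u) (hus : ∀ k, u k ∈ s) : ∃ x ∈ s, Tendsto u atTop (𝓝 x) := by
  have hmem : ∀ᶠ k in atTop, u k ∈ s := Eventually.of_forall hus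
  obtain ⟨x, hx, hxu⟩ := hs.exists_mapClusterPt (tendsto_principal.2 hmem)
  have upper : ∀ {y}, MapClusterPt y atTop u → ∀ k, u k ≤ y := fun hy k ↦
    isClosed_Ici.mem_of_mapClusterPt hy (eventually_ge_atTop k |>.mono fun _ hj ↦ hu hj)
  have least : ∀ {y z}, MapClusterPt y atTop u → (∀ k, u k ≤ z) → y ≤ z := fun hy hz ↦
    isClosed_Iic.mem_of_mapClusterPt hy (Eventually.of_forall hz)
  exact ⟨x, hx, hs.tendsto_nhds_of_unique_mapClusterPt hmem fun y _ hy ↦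
    le_antisymm (least hy (upper hxu)) (least hxu (upper hy))⟩

lemma exists_isFixedPt_mem_Icc {f : α → α} {a b : α} (hab : a ≤ b) (hc : IsCompact (Icc a b))
    (hmono : MonotoneOn f (Icc a b)) (hcont : ContinuousOn f (Icc a b)) (ha : a ≤ f a)
    (hb : f b ≤ b) : ∃ x ∈ Icc a b, Function.IsFixedPt f x := by
  have hmaps : MapsTo f (Icc a b) (Icc a b) := fun x hx ↦
    ⟨ha.trans (hmono (left_mem_Icc.2 hab) hx hx.1), (hmono hx (right_mem_Icc.2 hab) hx.2).trans hb⟩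
  have hmem (k : ℕ) : f^[k] a ∈ Icc a b := hmaps.iterate k (left_mem_Icc.2 hab)
  have hiter : Monotone fun k ↦ f^[k] a := by
    refine monotone_nat_of_le_succ fun k ↦ ?_
    induction k with
    | zero => exact ha
    | succ k ih =>
      simp only [Function.iterate_succ_apply'] at ih ⊢
      exact hmono (hmem k) (by simpa only [Function.iterate_succ_apply'] using hmem (k + 1)) ih
  obtain ⟨x, hx, hlim⟩ := exists_tendsto_of_monotone_of_isCompact hc hiter hmem
  have := OrderClosedTopology.to_t2Space (α := α)
  have hstep : Tendsto (fun k ↦ f^[k + 1] a) atTop (𝓝 (f x)) := by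
    simp only [Function.iterate_succ_apply']
    exact (hcont x hx).tendsto.comp
      (tendsto_nhdsWithin_iff.2 ⟨hlim, Eventually.of_forall hmem⟩)
  exact ⟨x, hx, tendsto_nhds_unique hstep (hlim.comp (tendsto_add_atTop_nat 1))⟩

end FixedPoint
section Lyapunov

lemma exists_eventually_norm_pow_le {A : Type*} [NormedRing A] [NormedAlgebra ℂ A]
    [CompleteSpace A] {a : A} (ha : spectralRadius ℂ a < 1) :
    ∃ r ∈ Ico (0 : ℝ) 1, ∀ᶠ k in atTop, ‖a ^ k‖ ≤ r ^ k := by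
  obtain ⟨r, har, hr⟩ := ENNReal.lt_iff_exists_nnreal_btwn.1 ha
  refine ⟨r, ⟨r.coe_nonneg, mod_cast hr⟩, ?_⟩
  have hgelfand := spectrum.pow_nnnorm_pow_one_div_tendsto_nhds_spectralRadius a
  filter_upwards [hgelfand.eventually_lt_const har, eventually_gt_atTop 0] with k hk hk0
  have hpow := ENNReal.rpow_le_rpow hk.le k.cast_nonneg
  rw [← ENNReal.rpow_mul, one_div_mul_cancel (Nat.cast_ne_zero.2 hk0.ne'), ENNReal.rpow_one,
    ENNReal.rpow_natCast] at hpow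
  exact_mod_cast hpow

variable {𝕜 m n : Type*} [RCLike 𝕜]

lemma norm_toLp_algebraMap_comp [Fintype n] (x : n → ℝ) :
    ‖WithLp.toLp 2 (algebraMap ℝ 𝕜 ∘ x)‖ = ‖WithLp.toLp 2 x‖ := by
  simp [EuclideanSpace.norm_eq]

lemma map_algebraMap_nonneg [Finite n] {P : Matrix n n ℝ} (hP : 0 ≤ P) :
    0 ≤ P.map (algebraMap ℝ 𝕜) := by
  cases nonempty_fintype n
  classical
  obtain ⟨Y, rfl⟩ := CStarAlgebra.nonneg_iff_eq_star_mul_self.1 hP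
  rw [Matrix.map_mul, star_eq_conjTranspose, conjTranspose_map]
  · exact conjTranspose_mul_self_nonneg _
  · intro x; simp

lemma map_algebraMap_posDef [Finite n] {Q : Matrix n n ℝ} (hQ : Q.PosDef) :
    (Q.map (algebraMap ℝ 𝕜)).PosDef := by
  cases nonempty_fintype n
  classical
  exact ((map_algebraMap_nonneg hQ.posSemidef.nonneg).posSemidef.posDef_iff_isUnit).2
    (hQ.isUnit.map (algebraMap ℝ 𝕜).mapMatrix)

variable [Fintype n]

lemma norm_lt_one_of_mulVec_eq_smul {L X Q : Matrix n n 𝕜} (hX : 0 ≤ X) (hQ : Q.PosDef)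
    (h : Lᴴ * X * L + Q ≤ X) {z : 𝕜} {v : n → 𝕜} (hv : v ≠ 0) (hLv : L *ᵥ v = z • v) :
    ‖z‖ < 1 := by
  have hquad : star v ⬝ᵥ (Lᴴ * X * L) *ᵥ v = (‖z‖ ^ 2 : ℝ) * (star v ⬝ᵥ X *ᵥ v) := by
    rw [← mulVec_mulVec, ← mulVec_mulVec, dotProduct_mulVec, ← star_mulVec, hLv, mulVec_smul,
      star_smul, smul_dotProduct, dotProduct_smul, smul_eq_mul, smul_eq_mul, ← mul_assoc,
      RCLike.star_def, RCLike.conj_mul, RCLike.ofReal_pow]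
  have hXv := RCLike.nonneg_iff.1 (hX.posSemidef.dotProduct_mulVec_nonneg v)
  have hQv := RCLike.pos_iff.1 (hQ.dotProduct_mulVec_pos hv)
  have hle := RCLike.nonneg_iff.1 ((sub_nonneg.2 h).posSemidef.dotProduct_mulVec_nonneg v)
  rw [sub_mulVec, add_mulVec, dotProduct_sub, dotProduct_add, hquad, map_sub, map_add,
    RCLike.re_ofReal_mul] at hle
  by_contra! hz
  nlinarith [one_le_pow₀ hz (n := 2)]

variable [DecidableEq n]

lemma norm_le_norm_map_algebraMap [Fintype m] (M : Matrix m n ℝ) :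
    ‖M‖ ≤ ‖M.map (algebraMap ℝ 𝕜)‖ := by
  rw [l2_opNorm_def]
  refine ContinuousLinearMap.opNorm_le_bound _ (norm_nonneg _) fun x ↦ ?_
  have hmap : M.map (algebraMap ℝ 𝕜) *ᵥ (algebraMap ℝ 𝕜 ∘ x) = algebraMap ℝ 𝕜 ∘ (M *ᵥ x) :=
    funext fun i ↦ (RingHom.map_mulVec (algebraMap ℝ 𝕜) M x i).symm
  have h := l2_opNorm_mulVec (M.map (algebraMap ℝ 𝕜)) (WithLp.toLp 2 (algebraMap ℝ 𝕜 ∘ x))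
  rw [hmap, norm_toLp_algebraMap_comp] at h
  exact (norm_toLp_algebraMap_comp (𝕜 := 𝕜) (M *ᵥ x)).symm.trans_le h

lemma exists_eq_conjTranspose_mul_mul_add {L Q : Matrix n n 𝕜} {r : ℝ} (hr : r ∈ Ico 0 1)
    (hL : ∀ᶠ k in atTop, ‖L ^ k‖ ≤ r ^ k) (hQ : 0 ≤ Q) : ∃ X, 0 ≤ X ∧ Lᴴ * X * L + Q = X := by
  have hsummable : Summable fun k ↦ (L ^ k)ᴴ * Q * L ^ k := by
    refine Summable.of_norm_bounded_eventually_nat (g := fun k ↦ ‖Q‖ * r ^ k)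
      ((summable_geometric_of_lt_one hr.1 hr.2).mul_left _) ?_
    filter_upwards [hL] with k hk
    calc ‖(L ^ k)ᴴ * Q * L ^ k‖ ≤ ‖(L ^ k)ᴴ‖ * ‖Q‖ * ‖L ^ k‖ := norm_mul₃_le
      _ ≤ 1 * ‖Q‖ * r ^ k := by
        rw [l2_opNorm_conjTranspose]
        gcongr
        exact hk.trans (pow_le_one₀ hr.1 hr.2.le)
      _ = ‖Q‖ * r ^ k := by rw [one_mul]
  refine ⟨∑' k, (L ^ k)ᴴ * Q * L ^ k,
    tsum_nonneg fun k ↦ conjTranspose_mul_mul_nonneg hQ _, ?_⟩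
  rw [← hsummable.tsum_mul_left, ← (hsummable.mul_left _).tsum_mul_right,
    hsummable.tsum_eq_zero_add, add_comm]
  simp [pow_succ, Matrix.mul_assoc]

lemma spectralRadius_lt_one_of_lyapunov {L X Q : Matrix n n ℂ} (hX : 0 ≤ X) (hQ : Q.PosDef)
    (h : Lᴴ * X * L + Q ≤ X) : spectralRadius ℂ L < 1 := by
  rcases isEmpty_or_nonempty n with _ | _
  · rw [spectrum.SpectralRadius.of_subsingleton]
    exact zero_lt_one
  refine spectrum.spectralRadius_lt_of_forall_lt L (r := 1) fun z hz ↦ ?_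
  rw [← spectrum_toLin', ← Module.End.hasEigenvalue_iff_mem_spectrum] at hz
  obtain ⟨v, hv⟩ := hz.exists_hasEigenvector
  exact norm_lt_one_of_mulVec_eq_smul hX hQ h hv.2 (by simpa using hv.apply_eq_smul)

end Lyapunov

section Riccati

variable {𝕜 n m : Type*} [RCLike 𝕜] [Fintype n] [Fintype m]
  {Rx A P X : Matrix n n 𝕜} {Ru : Matrix m m 𝕜} {B : Matrix n m 𝕜}

/-- The cost of playing the feedback `K` for one step when the terminal cost is `P`; its fixed
points are the costs of playing `K` forever. -/
def stepCost (Rx : Matrix n n 𝕜) (Ru : Matrix m m 𝕜) (A : Matrix n n 𝕜) (B : Matrix n m 𝕜)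
    (K : Matrix m n 𝕜) (P : Matrix n n 𝕜) : Matrix n n 𝕜 :=
  (A + B * K)ᴴ * P * (A + B * K) + (Kᴴ * Ru * K + Rx)

lemma stepCost_sub_stepCost (K : Matrix m n 𝕜) :
    stepCost Rx Ru A B K X - stepCost Rx Ru A B K P = (A + B * K)ᴴ * (X - P) * (A + B * K) := by
  rw [stepCost, stepCost, add_sub_add_right_eq_sub, Matrix.mul_sub, Matrix.sub_mul]

lemma stepCost_mono (K : Matrix m n 𝕜) (h : P ≤ X) :
    stepCost Rx Ru A B K P ≤ stepCost Rx Ru A B K X := by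
  rw [← sub_nonneg, stepCost_sub_stepCost]
  exact conjTranspose_mul_mul_nonneg (sub_nonneg.2 h) _

lemma le_stepCost (hRu : 0 ≤ Ru) (hP : 0 ≤ P) (K : Matrix m n 𝕜) :
    Rx ≤ stepCost Rx Ru A B K P :=
  le_add_of_nonneg_of_le (conjTranspose_mul_mul_nonneg hP _)
    (le_add_of_nonneg_left (conjTranspose_mul_mul_nonneg hRu _))

variable [DecidableEq m]

/-- The right-hand side of the discrete algebraic Riccati equation. -/
noncomputable def riccati (Rx : Matrix n n 𝕜) (Ru : Matrix m m 𝕜) (A : Matrix n n 𝕜)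
    (B : Matrix n m 𝕜) (P : Matrix n n 𝕜) : Matrix n n 𝕜 :=
  Aᴴ * P * A - Aᴴ * P * B * (Ru + Bᴴ * P * B)⁻¹ * Bᴴ * P * A + Rx

/-- The feedback minimizing `stepCost` for the terminal cost `P`. -/
noncomputable def gain (Ru : Matrix m m 𝕜) (A : Matrix n n 𝕜) (B : Matrix n m 𝕜)
    (P : Matrix n n 𝕜) : Matrix m n 𝕜 :=
  -((Ru + Bᴴ * P * B)⁻¹ * (Bᴴ * P * A))

lemma stepCost_eq_riccati_add (hRu : Ru.PosDef) (hP : 0 ≤ P) (K : Matrix m n 𝕜) :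
    stepCost Rx Ru A B K P = riccati Rx Ru A B P
      + (K - gain Ru A B P)ᴴ * (Ru + Bᴴ * P * B) * (K - gain Ru A B P) := by
  have hS := posDef_add_conjTranspose_mul_mul hRu hP B
  have hdet : IsUnit (Ru + Bᴴ * P * B).det := (isUnit_iff_isUnit_det _).1 hS.isUnit
  have hSgain : (Ru + Bᴴ * P * B) * gain Ru A B P = -(Bᴴ * P * A) := by
    rw [gain, Matrix.mul_neg, mul_nonsing_inv_cancel_left _ _ hdet]
  have hgainS : (gain Ru A B P)ᴴ * (Ru + Bᴴ * P * B) = -(Aᴴ * P * B) := by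
    have := congrArg conjTranspose hSgain
    rw [conjTranspose_mul, hS.isHermitian.eq] at this
    simpa only [conjTranspose_mul, conjTranspose_neg, conjTranspose_conjTranspose,
      hP.posSemidef.isHermitian.eq, Matrix.mul_assoc] using this
  have hsq : (K - gain Ru A B P)ᴴ * (Ru + Bᴴ * P * B) * (K - gain Ru A B P)
      = Kᴴ * (Ru + Bᴴ * P * B) * K + Kᴴ * (Bᴴ * P * A) + Aᴴ * P * B * K
        + Aᴴ * P * B * (Ru + Bᴴ * P * B)⁻¹ * (Bᴴ * P * A) := by
    rw [conjTranspose_sub, Matrix.sub_mul, hgainS, Matrix.mul_sub, Matrix.sub_mul, Matrix.sub_mul,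
      Matrix.mul_assoc _ _ (gain Ru A B P), hSgain, gain]
    simp only [Matrix.mul_neg, Matrix.neg_mul, Matrix.mul_assoc]
    abel
  rw [hsq, stepCost, riccati]
  simp only [conjTranspose_add, conjTranspose_mul, Matrix.add_mul, Matrix.mul_add,
    Matrix.mul_assoc]
  abel

lemma riccati_le_stepCost (hRu : Ru.PosDef) (hP : 0 ≤ P) (K : Matrix m n 𝕜) :
    riccati Rx Ru A B P ≤ stepCost Rx Ru A B K P := by
  rw [stepCost_eq_riccati_add hRu hP]
  exact le_add_of_nonneg_right (conjTranspose_mul_mul_nonneg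
    (posDef_add_conjTranspose_mul_mul hRu hP B).posSemidef.nonneg _)

lemma stepCost_gain (hRu : Ru.PosDef) (hP : 0 ≤ P) :
    stepCost Rx Ru A B (gain Ru A B P) P = riccati Rx Ru A B P := by
  simp [stepCost_eq_riccati_add hRu hP]

lemma riccati_mono (hRu : Ru.PosDef) (hP : 0 ≤ P) (h : P ≤ X) :
    riccati Rx Ru A B P ≤ riccati Rx Ru A B X :=
  calc riccati Rx Ru A B P ≤ stepCost Rx Ru A B (gain Ru A B X) P := riccati_le_stepCost hRu hP _
    _ ≤ stepCost Rx Ru A B (gain Ru A B X) X := stepCost_mono _ h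
    _ = riccati Rx Ru A B X := stepCost_gain hRu (hP.trans h)

lemma continuousAt_riccati (hRu : Ru.PosDef) (hP : 0 ≤ P) :
    ContinuousAt (riccati Rx Ru A B) P := by
  have hS := (posDef_add_conjTranspose_mul_mul hRu hP B).isUnit
  have hinv : ContinuousAt (fun S : Matrix m m 𝕜 ↦ S⁻¹) (Ru + Bᴴ * P * B) := by
    simp only [nonsing_inv_eq_ringInverse]
    exact hS.unit_spec ▸ NormedRing.inverse_continuousAt hS.unit
  have hcomp : ContinuousAt (fun P : Matrix n n 𝕜 ↦ (Ru + Bᴴ * P * B)⁻¹) P :=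
    ContinuousAt.comp (f := fun P : Matrix n n 𝕜 ↦ Ru + Bᴴ * P * B) hinv (by fun_prop)
  unfold riccati
  fun_prop

lemma exists_riccati_eq_le (hRx : 0 ≤ Rx) (hRu : Ru.PosDef) (hX : 0 ≤ X)
    (h : riccati Rx Ru A B X ≤ X) : ∃ P, 0 ≤ P ∧ P ≤ X ∧ riccati Rx Ru A B P = P := by
  have hzero : 0 ≤ riccati Rx Ru A B 0 := by simpa [riccati] using hRx
  obtain ⟨P, hP, hfix⟩ := exists_isFixedPt_mem_Icc hX (isCompact_Icc_zero X)
    (fun P hP _ _ hle ↦ riccati_mono hRu hP.1 hle)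
    (fun P hP ↦ (continuousAt_riccati hRu hP.1).continuousWithinAt) hzero h
  exact ⟨P, hP.1, hP.2, hfix⟩

end Riccati

section Comparison

variable {𝕜 n : Type*} [RCLike 𝕜] [Fintype n] [DecidableEq n]

lemma nonpos_of_le_conjTranspose_mul_mul {L D : Matrix n n 𝕜}
    (hL : Tendsto (fun k ↦ L ^ k) atTop (𝓝 0)) (hD : D ≤ Lᴴ * D * L) : D ≤ 0 := by
  have hle (k : ℕ) : D ≤ (L ^ k)ᴴ * D * L ^ k := by
    induction k with
    | zero => simp
    | succ k ih =>
      calc D ≤ Lᴴ * D * L := hD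
        _ ≤ Lᴴ * ((L ^ k)ᴴ * D * L ^ k) * L := conjTranspose_mul_mul_mono ih L
        _ = (L ^ (k + 1))ᴴ * D * L ^ (k + 1) := by
          simp only [pow_succ, conjTranspose_mul, Matrix.mul_assoc]
  have hlim : Tendsto (fun k ↦ (L ^ k)ᴴ * D * L ^ k) atTop (𝓝 0) := by
    have hcont : Continuous fun M : Matrix n n 𝕜 ↦ Mᴴ * D * M := by fun_prop
    simpa [Function.comp_def] using (hcont.tendsto 0).comp hL
  exact ge_of_tendsto' hlim hle

end Comparison

section Perturbation

variable {𝕜 n m : Type*} [RCLike 𝕜] [Fintype m] [DecidableEq n] [DecidableEq m]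

lemma one_add_conjTranspose_mul_self_le [Finite n] {Rx : Matrix n n 𝕜} {Ru : Matrix m m 𝕜}
    (hRx : 1 ≤ Rx) (hRu : 1 ≤ Ru) (K : Matrix m n 𝕜) : 1 + Kᴴ * K ≤ Kᴴ * Ru * K + Rx := by
  rw [add_comm]
  simpa using add_le_add (conjTranspose_mul_mul_mono hRu K) hRx

variable [Fintype n]

lemma conjTranspose_add_mul_mul_self_le {E : Matrix n n 𝕜} {F : Matrix n m 𝕜} {ε : ℝ}
    (hE : ‖E‖ ≤ ε) (hF : ‖F‖ ≤ ε) (K : Matrix m n 𝕜) :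
    (E + F * K)ᴴ * (E + F * K) ≤ (2 * ε ^ 2) • (1 + Kᴴ * K) := by
  have hEE : Eᴴ * E ≤ ε ^ 2 • 1 := (conjTranspose_mul_self_le_norm_sq_smul_one E).trans
    (smul_le_smul_of_nonneg_right (by gcongr) zero_le_one)
  have hFF : Fᴴ * F ≤ ε ^ 2 • 1 := (conjTranspose_mul_self_le_norm_sq_smul_one F).trans
    (smul_le_smul_of_nonneg_right (by gcongr) zero_le_one)
  have hFK : (F * K)ᴴ * (F * K) ≤ ε ^ 2 • (Kᴴ * K) := by
    simpa [Matrix.mul_assoc] using conjTranspose_mul_mul_mono hFF K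
  calc (E + F * K)ᴴ * (E + F * K) ≤ (2 : ℝ) • (Eᴴ * E) + (2 : ℝ) • ((F * K)ᴴ * (F * K)) := by
        simpa [one_add_one_eq_two] using
          conjTranspose_add_mul_mul_add_le (zero_le_one' (Matrix n n 𝕜)) E (F * K) one_pos
    _ ≤ (2 : ℝ) • (ε ^ 2 • 1) + (2 : ℝ) • (ε ^ 2 • (Kᴴ * K)) := by gcongr
    _ = (2 * ε ^ 2) • (1 + Kᴴ * K) := by module

variable {Rx A A' P : Matrix n n 𝕜} {Ru : Matrix m m 𝕜} {B B' : Matrix n m 𝕜} {K : Matrix m n 𝕜}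
  {ε : ℝ}

lemma conjTranspose_mul_mul_le_sub_of_stepCost_le (hRx : 1 ≤ Rx) (hRu : 1 ≤ Ru) (hP : 0 ≤ P)
    (h : stepCost Rx Ru A B K P ≤ P) (hε : 0 < ε) (hA : ‖A' - A‖ ≤ ε) (hB : ‖B' - B‖ ≤ ε) :
    (A' + B' * K)ᴴ * P * (A' + B' * K)
      ≤ P - (1 - ε * ‖P‖ * (3 + 2 * ε)) • (Kᴴ * Ru * K + Rx) := by
  set p := ‖P‖
  set Q := Kᴴ * Ru * K + Rx
  set L := A + B * K
  set D := (A' - A) + (B' - B) * K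
  have hone : 1 + Kᴴ * K ≤ Q := one_add_conjTranspose_mul_self_le hRx hRu K
  have hQone : 1 ≤ Q := (le_add_of_nonneg_right (conjTranspose_mul_self_nonneg K)).trans hone
  have hPp : P ≤ p • 1 := le_norm_smul_one hP.posSemidef.isHermitian
  have hPQ : P ≤ p • Q := hPp.trans (smul_le_smul_of_nonneg_left hQone (norm_nonneg P))
  have hLP : Lᴴ * P * L ≤ P - Q := le_sub_right_of_add_le h
  have hDP : Dᴴ * P * D ≤ (2 * ε ^ 2 * p) • Q :=
    calc Dᴴ * P * D ≤ p • (Dᴴ * D) := by simpa using conjTranspose_mul_mul_mono hPp D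
      _ ≤ p • ((2 * ε ^ 2) • (1 + Kᴴ * K)) := by
        gcongr
        exact conjTranspose_add_mul_mul_self_le hA hB K
      _ ≤ p • ((2 * ε ^ 2) • Q) := by gcongr
      _ = (2 * ε ^ 2 * p) • Q := by module
  have hsplit : A' + B' * K = L + D := by
    simp only [L, D, Matrix.sub_mul]
    abel
  rw [hsplit]
  calc (L + D)ᴴ * P * (L + D) ≤ (1 + ε) • (Lᴴ * P * L) + (1 + ε⁻¹) • (Dᴴ * P * D) :=
        conjTranspose_add_mul_mul_add_le hP L D hε
    _ ≤ (1 + ε) • (P - Q) + (1 + ε⁻¹) • ((2 * ε ^ 2 * p) • Q) := by gcongr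
    _ = P - Q + ε • P + (2 * ε * p * (1 + ε)) • Q - ε • Q := by
      match_scalars <;> field_simp <;> ring
    _ ≤ P - Q + ε • (p • Q) + (2 * ε * p * (1 + ε)) • Q - 0 := by
      gcongr
      exact smul_nonneg hε.le (zero_le_one.trans hQone)
    _ = P - (1 - ε * p * (3 + 2 * ε)) • Q := by module

lemma stepCost_smul_le_smul (hRx : 1 ≤ Rx) (hRu : 1 ≤ Ru) (hP : 0 ≤ P)
    (h : stepCost Rx Ru A B K P ≤ P) (hε : 0 < ε) (hA : ‖A' - A‖ ≤ ε) (hB : ‖B' - B‖ ≤ ε)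
    (hlt : ε * ‖P‖ * (3 + 2 * ε) < 1) :
    stepCost Rx Ru A' B' K ((1 - ε * ‖P‖ * (3 + 2 * ε))⁻¹ • P)
      ≤ (1 - ε * ‖P‖ * (3 + 2 * ε))⁻¹ • P := by
  have hle := conjTranspose_mul_mul_le_sub_of_stepCost_le hRx hRu hP h hε hA hB
  set c := 1 - ε * ‖P‖ * (3 + 2 * ε)
  have hc : 0 < c := sub_pos.2 hlt
  calc stepCost Rx Ru A' B' K (c⁻¹ • P)
      = c⁻¹ • ((A' + B' * K)ᴴ * P * (A' + B' * K)) + (Kᴴ * Ru * K + Rx) := by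
        rw [stepCost, Matrix.mul_smul, Matrix.smul_mul]
    _ ≤ c⁻¹ • (P - c • (Kᴴ * Ru * K + Rx)) + (Kᴴ * Ru * K + Rx) := by gcongr
    _ = c⁻¹ • P := by rw [smul_sub, inv_smul_smul₀ hc.ne', sub_add_cancel]

end Perturbation

section Stability

variable {n m : ℕ} {L X Q : Matrix (Fin n) (Fin n) ℝ}

lemma IsStable.exists_eventually_norm_pow_le (hL : IsStable L) :
    ∃ r ∈ Ico (0 : ℝ) 1, ∀ᶠ k in atTop, ‖L ^ k‖ ≤ r ^ k := by
  obtain ⟨r, hr, hle⟩ := LQR.exists_eventually_norm_pow_le hL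
  refine ⟨r, hr, hle.mono fun k hk ↦ (norm_le_norm_map_algebraMap (𝕜 := ℂ) _).trans ?_⟩
  rwa [Matrix.map_pow]

lemma IsStable.tendsto_pow (hL : IsStable L) : Tendsto (fun k ↦ L ^ k) atTop (𝓝 0) := by
  obtain ⟨r, hr, hle⟩ := hL.exists_eventually_norm_pow_le
  exact squeeze_zero_norm' hle (tendsto_pow_atTop_nhds_zero_of_lt_one hr.1 hr.2)

lemma isStable_of_lyapunov (hX : 0 ≤ X) (hQ : Q.PosDef) (h : Lᴴ * X * L + Q ≤ X) :
    IsStable L := by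
  refine spectralRadius_lt_one_of_lyapunov (map_algebraMap_nonneg hX)
    (map_algebraMap_posDef hQ) (sub_nonneg.1 ?_)
  have hmap := map_algebraMap_nonneg (𝕜 := ℂ) (sub_nonneg.2 h)
  rwa [Matrix.map_sub _ (map_sub _), Matrix.map_add _ (map_add _), Matrix.map_mul, Matrix.map_mul,
    conjTranspose_map _ fun x ↦ by simp] at hmap

end Stability

section DARE

variable {n m : ℕ} {Rx A P P' X : Matrix (Fin n) (Fin n) ℝ} {Ru : Matrix (Fin m) (Fin m) ℝ}
  {B : Matrix (Fin n) (Fin m) ℝ}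

lemma isDARESolution_iff : IsDARESolution Rx Ru A B P ↔ 0 ≤ P ∧ riccati Rx Ru A B P = P := by
  simp only [IsDARESolution, riccati, conjTranspose_eq_transpose_of_trivial,
    nonneg_iff_posSemidef, eq_comm]

lemma exists_isDARESolution_le (hRx : 0 ≤ Rx) (hRu : Ru.PosDef) (hX : 0 ≤ X)
    {K : Matrix (Fin m) (Fin n) ℝ} (h : stepCost Rx Ru A B K X ≤ X) :
    ∃ P, IsDARESolution Rx Ru A B P ∧ P ≤ X := by
  obtain ⟨P, hP, hPX, hfix⟩ :=
    exists_riccati_eq_le hRx hRu hX ((riccati_le_stepCost hRu hX K).trans h)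
  exact ⟨P, isDARESolution_iff.2 ⟨hP, hfix⟩, hPX⟩

lemma IsStabilizable.exists_isDARESolution (hRx : 0 ≤ Rx) (hRu : Ru.PosDef)
    (h : IsStabilizable A B) : ∃ P, IsDARESolution Rx Ru A B P := by
  obtain ⟨K, hK⟩ := h
  obtain ⟨r, hr, hle⟩ := hK.exists_eventually_norm_pow_le
  obtain ⟨X, hX, hfix⟩ := exists_eq_conjTranspose_mul_mul_add hr hle
    (add_nonneg (conjTranspose_mul_mul_nonneg hRu.posSemidef.nonneg K) hRx)
  obtain ⟨P, hP, -⟩ := exists_isDARESolution_le hRx hRu hX (K := K) hfix.le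
  exact ⟨P, hP⟩

namespace IsDARESolution

lemma nonneg (h : IsDARESolution Rx Ru A B P) : 0 ≤ P :=
  (isDARESolution_iff.1 h).1

lemma stepCost_gain (hRu : Ru.PosDef) (h : IsDARESolution Rx Ru A B P) :
    stepCost Rx Ru A B (gain Ru A B P) P = P := by
  rw [LQR.stepCost_gain hRu h.nonneg, (isDARESolution_iff.1 h).2]

lemma le (hRu : Ru.PosDef) (h : IsDARESolution Rx Ru A B P) : Rx ≤ P :=
  (le_stepCost hRu.posSemidef.nonneg h.nonneg _).trans_eq (h.stepCost_gain hRu)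

lemma isStable_closedLoop (hRx : Rx.PosDef) (hRu : Ru.PosDef) (h : IsDARESolution Rx Ru A B P) :
    IsStable (A + B * gain Ru A B P) :=
  isStable_of_lyapunov h.nonneg
    (hRx.posSemidef_add (hRu.posSemidef.conjTranspose_mul_mul_same (gain Ru A B P)))
    (h.stepCost_gain hRu).le

lemma isStabilizable (hRx : Rx.PosDef) (hRu : Ru.PosDef) (h : IsDARESolution Rx Ru A B P) :
    IsStabilizable A B :=
  ⟨_, h.isStable_closedLoop hRx hRu⟩

lemma le_of_isDARESolution (hRx : Rx.PosDef) (hRu : Ru.PosDef) (h : IsDARESolution Rx Ru A B P)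
    (h' : IsDARESolution Rx Ru A B P') : P ≤ P' := by
  refine sub_nonpos.1 (nonpos_of_le_conjTranspose_mul_mul
    (h'.isStable_closedLoop hRx hRu).tendsto_pow ?_)
  rw [← stepCost_sub_stepCost (Rx := Rx) (Ru := Ru), h'.stepCost_gain hRu]
  gcongr
  exact (isDARESolution_iff.1 h).2.ge.trans (riccati_le_stepCost hRu h.nonneg _)

lemma unique (hRx : Rx.PosDef) (hRu : Ru.PosDef) (h : IsDARESolution Rx Ru A B P)
    (h' : IsDARESolution Rx Ru A B P') : P = P' :=
  (h.le_of_isDARESolution hRx hRu h').antisymm (h'.le_of_isDARESolution hRx hRu h)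

lemma existsUnique (hRx : Rx.PosDef) (hRu : Ru.PosDef) (h : IsDARESolution Rx Ru A B P) :
    ∃! P, IsDARESolution Rx Ru A B P :=
  ⟨P, h, fun _ h' ↦ h'.unique hRx hRu h⟩

lemma pInfty_eq (hRx : Rx.PosDef) (hRu : Ru.PosDef) (h : IsDARESolution Rx Ru A B P) :
    PInfty Rx Ru A B = P := by
  have hex : ∃ P, IsDARESolution Rx Ru A B P := ⟨P, h⟩
  rw [PInfty, dif_pos hex]
  exact hex.choose_spec.unique hRx hRu h

lemma cSafe_eq (hRx : Rx.PosDef) (hRu : Ru.PosDef) (h : IsDARESolution Rx Ru A B P) :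
    CSafe Rx Ru A B = 54 * ‖P‖ ^ 5 := by
  rw [CSafe, h.pInfty_eq hRx hRu]

lemma one_le_norm [NeZero n] (hRx : 1 ≤ Rx) (hRu : Ru.PosDef) (h : IsDARESolution Rx Ru A B P) :
    1 ≤ ‖P‖ :=
  (norm_one (α := Matrix (Fin n) (Fin n) ℝ)).symm.trans_le
    (norm_mono zero_le_one (hRx.trans (h.le hRu)))

end IsDARESolution

end DARE

section OpBall

variable {n m : ℕ} {Rx A₀ A P₀ P : Matrix (Fin n) (Fin n) ℝ} {Ru : Matrix (Fin m) (Fin m) ℝ}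
  {B₀ B : Matrix (Fin n) (Fin m) ℝ} {ε : ℝ}

lemma IsDARESolution.exists_isDARESolution_of_norm_sub_le (hRx : 1 ≤ Rx) (hRu : 1 ≤ Ru)
    (h₀ : IsDARESolution Rx Ru A₀ B₀ P₀) (hε : 0 < ε) (hA : ‖A - A₀‖ ≤ ε) (hB : ‖B - B₀‖ ≤ ε)
    (hlt : ε * ‖P₀‖ * (3 + 2 * ε) < 1) :
    ∃ P, IsDARESolution Rx Ru A B P ∧ ‖P‖ ≤ (1 - ε * ‖P₀‖ * (3 + 2 * ε))⁻¹ * ‖P₀‖ := by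
  have hc := inv_nonneg.2 (sub_pos.2 hlt).le
  have hRu' := posDef_of_one_le hRu
  obtain ⟨P, hP, hle⟩ := exists_isDARESolution_le (zero_le_one.trans hRx) hRu'
    (smul_nonneg hc h₀.nonneg)
    (stepCost_smul_le_smul hRx hRu h₀.nonneg (h₀.stepCost_gain hRu').le hε hA hB hlt)
  exact ⟨P, hP, (norm_mono hP.nonneg hle).trans_eq (by rw [norm_smul, Real.norm_of_nonneg hc])⟩

lemma IsDARESolution.exists_isDARESolution_of_mem_opBall (hRx : 1 ≤ Rx) (hRu : 1 ≤ Ru)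
    (h₀ : IsDARESolution Rx Ru A₀ B₀ P₀)
    (h : (A, B) ∈ opBall (1 / (3 * CSafe Rx Ru A₀ B₀)) A₀ B₀) :
    ∃ P, IsDARESolution Rx Ru A B P ∧ ‖P‖ ≤ 1.0835 * ‖P₀‖ := by
  obtain rfl | hn := eq_or_ne n 0
  · obtain rfl := Subsingleton.elim A A₀
    obtain rfl := Subsingleton.elim B B₀
    exact ⟨P₀, h₀, by linarith [norm_nonneg P₀]⟩
  have := NeZero.mk hn
  have hRu' := posDef_of_one_le hRu
  have hone := h₀.one_le_norm hRx hRu'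
  have hp : 0 < ‖P₀‖ := one_pos.trans_le hone
  rw [h₀.cSafe_eq (posDef_of_one_le hRx) hRu'] at h
  set ε := 1 / (3 * (54 * ‖P₀‖ ^ 5))
  have hε : 0 < ε := by positivity
  have hεp : ε * ‖P₀‖ ≤ 1 / 162 := by
    have hεp_eq : ε * ‖P₀‖ = 1 / (162 * ‖P₀‖ ^ 4) := by
      simp only [ε]
      field_simp
      norm_num
    rw [hεp_eq]
    gcongr
    exact le_mul_of_one_le_right (by norm_num) (one_le_pow₀ hone)
  have hδ : ε * ‖P₀‖ * (3 + 2 * ε) ≤ 0.02 := by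
    nlinarith [le_mul_of_one_le_right hε.le hone]
  obtain ⟨P, hP, hnorm⟩ := h₀.exists_isDARESolution_of_norm_sub_le hRx hRu hε
    ((le_max_left _ _).trans h) ((le_max_right _ _).trans h) (hδ.trans_lt (by norm_num))
  refine ⟨P, hP, hnorm.trans ?_⟩
  gcongr
  rw [inv_le_comm₀ (by linarith) (by norm_num)]
  linarith

lemma max_norm_sub_le_of_mem_opBall
    {S T : Matrix (Fin n) (Fin n) ℝ × Matrix (Fin n) (Fin m) ℝ} (hS : S ∈ opBall ε A₀ B₀)
    (hT : T ∈ opBall ε A₀ B₀) : max ‖S.1 - T.1‖ ‖T.2 - S.2‖ ≤ 2 * ε := by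
  obtain ⟨hSA, hSB⟩ := max_le_iff.1 hS.out
  obtain ⟨hTA, hTB⟩ := max_le_iff.1 hT.out
  rw [two_mul]
  refine max_le ?_ ?_
  · exact (norm_sub_le_norm_sub_add_norm_sub _ A₀ _).trans
      (add_le_add hSA (norm_sub_rev A₀ T.1 ▸ hTA))
  · exact (norm_sub_le_norm_sub_add_norm_sub _ B₀ _).trans
      (add_le_add hTB (norm_sub_rev B₀ S.2 ▸ hSB))

lemma IsDARESolution.two_mul_one_div_le_one_div_cSafe (hRx : 1 ≤ Rx) (hRu : 1 ≤ Ru)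
    (h₀ : IsDARESolution Rx Ru A₀ B₀ P₀) (h : IsDARESolution Rx Ru A B P)
    (hnorm : ‖P‖ ≤ 1.0835 * ‖P₀‖) :
    2 * (1 / (3 * CSafe Rx Ru A₀ B₀)) ≤ 1 / CSafe Rx Ru A B := by
  have hRx' := posDef_of_one_le hRx
  have hRu' := posDef_of_one_le hRu
  rw [h₀.cSafe_eq hRx' hRu', h.cSafe_eq hRx' hRu']
  obtain rfl | hn := eq_or_ne n 0
  · simp [Subsingleton.elim P₀ 0, Subsingleton.elim P 0]
  have := NeZero.mk hn
  have hp₀ : 0 < ‖P₀‖ := one_pos.trans_le (h₀.one_le_norm hRx hRu')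
  have hp : 0 < ‖P‖ := one_pos.trans_le (h.one_le_norm hRx hRu')
  calc 2 * (1 / (3 * (54 * ‖P₀‖ ^ 5))) = 1 / (54 * (3 / 2 * ‖P₀‖ ^ 5)) := by field_simp
    _ ≤ 1 / (54 * ‖P‖ ^ 5) := by
      gcongr
      calc ‖P‖ ^ 5 ≤ (1.0835 * ‖P₀‖) ^ 5 := by gcongr
        _ = 1.0835 ^ 5 * ‖P₀‖ ^ 5 := mul_pow _ _ _
        _ ≤ 3 / 2 * ‖P₀‖ ^ 5 := by gcongr; norm_num

end OpBall

end LQR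

theorem mainTheorem9_general {n m : ℕ} (Rx : Matrix (Fin n) (Fin n) ℝ)
    (hRx : (Rx - 1).PosSemidef) (Ru : Matrix (Fin m) (Fin m) ℝ) (hRu : (Ru - 1).PosSemidef)
    (A₀ : Matrix (Fin n) (Fin n) ℝ) (B₀ : Matrix (Fin n) (Fin m) ℝ)
    (h₀ : LQR.IsStabilizable A₀ B₀)
    (Ahat : Matrix (Fin n) (Fin n) ℝ) (Bhat : Matrix (Fin n) (Fin m) ℝ)
    (hhat : (Ahat, Bhat) ∈ LQR.opBall (1 / (3 * LQR.CSafe Rx Ru A₀ B₀)) A₀ B₀)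
    (Astar : Matrix (Fin n) (Fin n) ℝ) (Bstar : Matrix (Fin n) (Fin m) ℝ)
    (hstar : (Astar, Bstar) ∈ LQR.opBall (1 / (3 * LQR.CSafe Rx Ru A₀ B₀)) A₀ B₀) :
    LQR.IsStabilizable Ahat Bhat ∧ LQR.IsStabilizable Astar Bstar ∧
    (∃! P, LQR.IsDARESolution Rx Ru A₀ B₀ P) ∧
    (∃! P, LQR.IsDARESolution Rx Ru Ahat Bhat P) ∧
    (∃! P, LQR.IsDARESolution Rx Ru Astar Bstar P) ∧
    max ‖Astar - Ahat‖ ‖Bhat - Bstar‖ ≤ 1 / LQR.CSafe Rx Ru Astar Bstar ∧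
    ‖LQR.PInfty Rx Ru Astar Bstar‖ ≤ 1.0835 * ‖LQR.PInfty Rx Ru A₀ B₀‖ := by
  have hx : 1 ≤ Rx := Matrix.le_iff.2 hRx
  have hu : 1 ≤ Ru := Matrix.le_iff.2 hRu
  have hx' := LQR.posDef_of_one_le hx
  have hu' := LQR.posDef_of_one_le hu
  obtain ⟨P₀, hP₀⟩ := h₀.exists_isDARESolution hx'.posSemidef.nonneg hu'
  obtain ⟨Phat, hPhat, -⟩ := hP₀.exists_isDARESolution_of_mem_opBall hx hu hhat
  obtain ⟨Pstar, hPstar, hnorm⟩ := hP₀.exists_isDARESolution_of_mem_opBall hx hu hstar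
  refine ⟨hPhat.isStabilizable hx' hu', hPstar.isStabilizable hx' hu',
    hP₀.existsUnique hx' hu', hPhat.existsUnique hx' hu', hPstar.existsUnique hx' hu', ?_, ?_⟩
  · exact (LQR.max_norm_sub_le_of_mem_opBall hstar hhat).trans
      (hP₀.two_mul_one_div_le_one_div_cSafe hx hu hPstar hnorm)
  · rwa [hPstar.pInfty_eq hx' hu', hP₀.pInfty_eq hx' hu']

theorem mainTheorem9 {n m : ℕ} (Rx : Matrix (Fin n) (Fin n) ℝ) (hRx : (Rx - 1).PosSemidef)
    (A₀ : Matrix (Fin n) (Fin n) ℝ) (B₀ : Matrix (Fin n) (Fin m) ℝ)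
    (h₀ : LQR.IsStabilizable A₀ B₀)
    (Ahat : Matrix (Fin n) (Fin n) ℝ) (Bhat : Matrix (Fin n) (Fin m) ℝ)
    (hhat : (Ahat, Bhat) ∈ LQR.opBall (1 / (3 * LQR.CSafe Rx 1 A₀ B₀)) A₀ B₀)
    (Astar : Matrix (Fin n) (Fin n) ℝ) (Bstar : Matrix (Fin n) (Fin m) ℝ)
    (hstar : (Astar, Bstar) ∈ LQR.opBall (1 / (3 * LQR.CSafe Rx 1 A₀ B₀)) A₀ B₀) :
    LQR.IsStabilizable Ahat Bhat ∧ LQR.IsStabilizable Astar Bstar ∧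
    (∃! P, LQR.IsDARESolution Rx 1 A₀ B₀ P) ∧
    (∃! P, LQR.IsDARESolution Rx 1 Ahat Bhat P) ∧
    (∃! P, LQR.IsDARESolution Rx 1 Astar Bstar P) ∧
    max ‖Astar - Ahat‖ ‖Bhat - Bstar‖ ≤ 1 / LQR.CSafe Rx 1 Astar Bstar ∧
    ‖LQR.PInfty Rx 1 Astar Bstar‖ ≤ 1.0835 * ‖LQR.PInfty Rx 1 A₀ B₀‖ :=
  mainTheorem9_general Rx hRx 1 (by simpa using Matrix.PosSemidef.zero) A₀ B₀ h₀ Ahat Bhat hhat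
    Astar Bstar hstar
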